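/- Let $r_{in},r_{out}:\mathbb{R}\to\mathbb{R}$ be continuous and $2\pi$-periodic with $0\le r_{in}<r_{out}$, and let $\Omega=\{(r\cos\theta,r\sin\theta): \theta\in[0,2\pi),\ r_{in}(\theta)\le r\le r_{out}(\theta)\}\subset\mathbb{R}^2$. Let $\rho:\Omega\to(0,\infty)$ be measurable with values in $[\underline\rho,\bar\rho]$. Let $U\supseteq\Omega$ be open and let $f:U\times\Omega\to\mathbb{R}$ be such that $f(x,\cdot)$ is integrable on $\Omega$ for every $x\in U$, $f(\cdot,q)$ is continuously differentiable on $U$ for every $q\in\Omega$, and $\partial f(x,q)/\partial x$ is bounded on $K\times\Omega$ for every compact $K\subset U$. Let $N\ge1$ and $\varphi_1,\dots,\varphi_N\in[0,2\pi)$, $\varphi_{N+1}=\varphi_1$. For $i=1,\dots,N$ let $E_i(\varphi)$ be the set of the points of $\Omega$ with polar coordinates $(r,\theta)$, $r_{in}(\theta)\le r\le r_{out}(\theta)$, such that $\varphi_i<\theta<\varphi_{i+1}$ if $\varphi_i\le\varphi_{i+1}$, and such that $\varphi_i<\theta<2\pi$ or $0\le\theta<\varphi_{i+1}$ if $\varphi_{i+1}<\varphi_i$.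 For positions $p=(p_1,\dots,p_N)$ put $$J(\varphi,p)=\sum_{j=1}^N\int_{E_j(\varphi)}f(p_j,q)\rho(q)\,dq,\qquad \nabla_{p_i}J(x)=\int_{E_i(\varphi)}\frac{\partial f(x,q)}{\partial x}\rho(q)\,dq .$$ Let $\mathrm D=[\underline a,\bar a]\times[\underline b,\bar b]\subset U$ with $\underline a\le\bar a$ and $\underline b\le\bar b$, let $\mathbf A=\frac12\mathrm{diag}(\bar a-\underline a,\bar b-\underline b)$, $\mathbf b=\frac12(\bar a+\underline a,\bar b+\underline b)^T$ and $I^2=[-1,1]^2$, and fix $i\in\{1,\dots,N\}$. Then, for every $x\in\mathrm D$ and all positions $p_j\in\Omega$ of the other agents, $\nabla_{p_i}J(x)$ is the gradient of $J(\varphi,p)$ with respect to $p_i$ at $p_i=x$. Moreover, if $$\langle\nabla_{p_i}J(\mathbf A\mathbf z+\mathbf b),\mathbf z\rangle>0\qquad\text{for all }\mathbf z\in\partial I^2,$$ then there is an $x\in\mathrm D$ with $\nabla_{p_i}J(x)=0$. -/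

import Mathlib

open MeasureTheory

noncomputable section

/-- The Euclidean plane `ℝ²`. -/
abbrev Plane : Type := EuclideanSpace ℝ (Fin 2)

/-- The point with polar coordinates `(r, θ)`. -/
def polarPoint (r θ : ℝ) : Plane := !₂[r * Real.cos θ, r * Real.sin θ]

/-- The points whose polar coordinates satisfy `θ ∈ T` and `rIn θ ≤ r ≤ rOut θ`. -/
def polarRegion (rIn rOut : ℝ → ℝ) (T : Set ℝ) : Set Plane :=
  {q | ∃ θ ∈ T, ∃ r ∈ Set.Icc (rIn θ) (rOut θ), q = polarPoint r θ}

/-- The data of the coverage problem with their standing assumptions. -/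
structure CoverageProblem where
  /-- Inner boundary curve of the coverage region, in polar form. -/
  rIn : ℝ → ℝ
  /-- Outer boundary curve of the coverage region, in polar form. -/
  rOut : ℝ → ℝ
  rIn_continuous : Continuous rIn
  rOut_continuous : Continuous rOut
  rIn_periodic : Function.Periodic rIn (2 * Real.pi)
  rOut_periodic : Function.Periodic rOut (2 * Real.pi)
  rIn_nonneg : ∀ θ, 0 ≤ rIn θ
  rIn_lt_rOut : ∀ θ, rIn θ < rOut θ
  /-- The density on the coverage region (its values elsewhere are irrelevant). -/
  ρ : Plane → ℝ
  ρLow : ℝ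
  ρHigh : ℝ
  ρ_aemeasurable :
    AEMeasurable ρ (volume.restrict (polarRegion rIn rOut (Set.Ico 0 (2 * Real.pi))))
  ρ_pos : ∀ q ∈ polarRegion rIn rOut (Set.Ico 0 (2 * Real.pi)), 0 < ρ q
  ρ_mem : ∀ q ∈ polarRegion rIn rOut (Set.Ico 0 (2 * Real.pi)), ρ q ∈ Set.Icc ρLow ρHigh
  /-- The cost `f x q` of moving from `x` to `q`. -/
  f : Plane → Plane → ℝ
  /-- An open set of admissible positions `x` (for instance the whole plane). -/
  dom : Set Plane
  dom_isOpen : IsOpen dom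
  region_subset_dom : polarRegion rIn rOut (Set.Ico 0 (2 * Real.pi)) ⊆ dom
  f_integrable : ∀ x ∈ dom,
    IntegrableOn (fun q => f x q) (polarRegion rIn rOut (Set.Ico 0 (2 * Real.pi)))
  f_contDiff : ∀ q ∈ polarRegion rIn rOut (Set.Ico 0 (2 * Real.pi)),
    ContDiffOn ℝ 1 (fun x => f x q) dom
  f_gradient_bounded : ∀ K ⊆ dom, IsCompact K →
    ∃ C : ℝ, ∀ x ∈ K, ∀ q ∈ polarRegion rIn rOut (Set.Ico 0 (2 * Real.pi)),
      ‖gradient (fun y => f y q) x‖ ≤ C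

namespace CoverageProblem

variable (P : CoverageProblem)

/-- The coverage region `Ω`. -/
def region : Set Plane := polarRegion P.rIn P.rOut (Set.Ico 0 (2 * Real.pi))

/-- The phase angles strictly between the `i`-th and the `(i+1)`-th partition bar, going
counterclockwise in `[0, 2π)`. Addition in `Fin N` is cyclic. -/
def phases {N : ℕ} [NeZero N] (φ : Fin N → ℝ) (i : Fin N) : Set ℝ :=
  if φ (i + 1) < φ i then
    {θ | (φ i < θ ∧ θ < 2 * Real.pi) ∨ (0 ≤ θ ∧ θ < φ (i + 1))}
  else
    {θ | φ i < θ ∧ θ < φ (i + 1)}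

/-- The subregion `E_i(φ)` in charge of the `i`-th agent. -/
def subregion {N : ℕ} [NeZero N] (φ : Fin N → ℝ) (i : Fin N) : Set Plane :=
  polarRegion P.rIn P.rOut (phases φ i)

/-- The performance index `J(φ, p) = ∑ᵢ ∫_{E_i(φ)} f(p_i, q) ρ(q) dq`. -/
def cost {N : ℕ} [NeZero N] (φ : Fin N → ℝ) (p : Fin N → Plane) : ℝ :=
  ∑ j, ∫ q in P.subregion φ j, P.f (p j) q * P.ρ q

/-- `∇_{p_i} J` at `p_i = x`, that is `∫_{E_i(φ)} ∂f(x, q)/∂x ρ(q) dq`. -/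
def gradCost {N : ℕ} [NeZero N] (φ : Fin N → ℝ) (i : Fin N) (x : Plane) : Plane :=
  ∫ q in P.subregion φ i, P.ρ q • gradient (fun y => P.f y q) x

end CoverageProblem

/-- The rectangle `[a₁, a₂] × [b₁, b₂]`. -/
def rectangle (a₁ a₂ b₁ b₂ : ℝ) : Set Plane :=
  {x | x 0 ∈ Set.Icc a₁ a₂ ∧ x 1 ∈ Set.Icc b₁ b₂}

/-- The matrix `A = ½ diag(a₂ - a₁, b₂ - b₁)`. -/
def scaleMatrix (a₁ a₂ b₁ b₂ : ℝ) : Matrix (Fin 2) (Fin 2) ℝ :=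
  (1 / 2 : ℝ) • Matrix.diagonal ![a₂ - a₁, b₂ - b₁]

/-- The centre `b = ½ (a₂ + a₁, b₂ + b₁)`. -/
def centre (a₁ a₂ b₁ b₂ : ℝ) : Plane := (1 / 2 : ℝ) • !₂[a₂ + a₁, b₂ + b₁]

/-- The map `z ↦ A z + b`. -/
def affineMap (a₁ a₂ b₁ b₂ : ℝ) (z : Plane) : Plane :=
  Matrix.toEuclideanLin (scaleMatrix a₁ a₂ b₁ b₂) z + centre a₁ a₂ b₁ b₂

end

/-! Bounded gradients and bounded density on a region of finite volume allow differentiation under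
the integral (`hasGradientAt_integral_of_bounded`), so `gradCost` is a true gradient. The existence
of a zero then needs neither a fixed-point theorem nor continuity of the field: `J` attains its
minimum over the compact rectangle. At an interior minimiser the gradient vanishes. At a boundary
minimiser `A z + b`, the direction `-z` stays in the rectangle and strictly decreases `J`, which is
impossible (`exists_gradient_eq_zero_of_outward`). -/

/-! ### Differentiation under the integral sign -/

open Filter Topology in
/-- The gradient of a parametric family is measurable in the parameter. -/
theorem aestronglyMeasurable_gradient {E α : Type*} [NormedAddCommGroup E]
    [InnerProductSpace ℝ E] [FiniteDimensional ℝ E] [MeasurableSpace α] {μ : Measure α}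
    {f : E → α → ℝ} {x : E} (hf : ∀ᶠ y in 𝓝 x, AEStronglyMeasurable (f y) μ)
    (hd : ∀ᵐ q ∂μ, DifferentiableAt ℝ (fun y => f y q) x) :
    AEStronglyMeasurable (fun q => gradient (fun y => f y q) x) μ := by
  have key : ∀ v : E, AEStronglyMeasurable (fun q => fderiv ℝ (fun y => f y q) x v) μ := by
    intro v
    have hn : Tendsto (fun n : ℕ => ‖(n : ℝ)‖) atTop atTop := by
      simpa using tendsto_natCast_atTop_atTop (R := ℝ)
    have hc : Tendsto (fun n : ℕ => x + (n : ℝ)⁻¹ • v) atTop (𝓝 x) := by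
      have h := ((tendsto_inv_atTop_nhds_zero_nat (𝕜 := ℝ)).smul_const v).const_add x
      rwa [zero_smul, add_zero] at h
    obtain ⟨n₀, hn₀⟩ := eventually_atTop.1 (hc.eventually hf)
    -- Directional derivatives are limits of difference quotients; the shift by `n₀` keeps every
    -- base point where `f` is known to be measurable.
    refine aestronglyMeasurable_of_tendsto_ae atTop
      (f := fun n q => ((n + n₀ : ℕ) : ℝ) • (f (x + ((n + n₀ : ℕ) : ℝ)⁻¹ • v) q - f x q))
      (fun n => ?_) ?_
    · exact ((hn₀ _ (Nat.le_add_left _ _)).sub hf.self_of_nhds).const_smul ((n + n₀ : ℕ) : ℝ)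
    · filter_upwards [hd] with q hq
      exact (hq.hasFDerivAt.lim v hn).comp (tendsto_add_atTop_nat n₀)
  let b := stdOrthonormalBasis ℝ E
  have hsum : (fun q => gradient (fun y => f y q) x) =
      fun q => ∑ k, fderiv ℝ (fun y => f y q) x (b k) • b k := by
    funext q
    rw [← b.sum_repr' (gradient (fun y => f y q) x)]
    refine Finset.sum_congr rfl fun k _ => ?_
    rw [real_inner_comm, gradient, InnerProductSpace.toDual_symm_apply]
  rw [hsum]
  exact Finset.aestronglyMeasurable_fun_sum _ fun k _ => (key _).smul_const _

/-- Differentiation under the integral sign, in terms of gradients. -/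
theorem hasGradientAt_integral_of_bounded {E α : Type*} [NormedAddCommGroup E]
    [InnerProductSpace ℝ E] [FiniteDimensional ℝ E] [MeasurableSpace α] {μ : Measure α}
    [IsFiniteMeasure μ] {f : E → α → ℝ} {ρ : α → ℝ} {U : Set E} {x : E} {C M : ℝ}
    (hU : U ∈ nhds x) (hf : ∀ y ∈ U, Integrable (f y) μ)
    (hd : ∀ᵐ q ∂μ, ∀ y ∈ U, DifferentiableAt ℝ (fun y => f y q) y)
    (hC : ∀ᵐ q ∂μ, ∀ y ∈ U, ‖gradient (fun y => f y q) y‖ ≤ C)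
    (hρ : AEStronglyMeasurable ρ μ) (hM : ∀ᵐ q ∂μ, ‖ρ q‖ ≤ M) :
    HasGradientAt (fun y => ∫ q, f y q * ρ q ∂μ)
      (∫ q, ρ q • gradient (fun y => f y q) x ∂μ) x := by
  have hx : x ∈ U := mem_of_mem_nhds hU
  have hgm : AEStronglyMeasurable (fun q => ρ q • gradient (fun y => f y q) x) μ :=
    hρ.smul (aestronglyMeasurable_gradient
      (Filter.mem_of_superset hU fun y hy => (hf y hy).aestronglyMeasurable)
      (hd.mono fun q hq => hq x hx))
  have hbound : ∀ᵐ q ∂μ, ∀ y ∈ U, ‖ρ q • gradient (fun y => f y q) y‖ ≤ M * C := by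
    filter_upwards [hC, hM] with q h1 h2 y hy
    rw [norm_smul]
    exact mul_le_mul h2 (h1 y hy) (norm_nonneg _) ((norm_nonneg _).trans h2)
  have hgi : Integrable (fun q => ρ q • gradient (fun y => f y q) x) μ :=
    Integrable.of_bound hgm (M * C) (hbound.mono fun q hq => hq x hx)
  rw [hasGradientAt_iff_hasFDerivAt]
  have hcomm : InnerProductSpace.toDual ℝ E (∫ q, ρ q • gradient (fun y => f y q) x ∂μ) =
      ∫ q, InnerProductSpace.toDual ℝ E (ρ q • gradient (fun y => f y q) x) ∂μ :=
    ((InnerProductSpace.toDual ℝ E).toContinuousLinearEquiv.toContinuousLinearMap.integral_comp_comm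
      hgi).symm
  rw [hcomm]
  have hint : ∀ y ∈ U, Integrable (fun q => f y q * ρ q) μ :=
    fun y hy => (hf y hy).mul_bdd hρ hM
  refine hasFDerivAt_integral_of_dominated_of_fderiv_le (s := U) (bound := fun _ => M * C)
    (F' := fun y q => InnerProductSpace.toDual ℝ E (ρ q • gradient (fun y => f y q) y))
    hU (Filter.mem_of_superset hU fun y hy => (hint y hy).aestronglyMeasurable) (hint x hx)
    ((InnerProductSpace.toDual ℝ E).continuous.comp_aestronglyMeasurable hgm) ?_
    (integrable_const _) ?_
  · filter_upwards [hbound] with q hq y hy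
    rw [LinearIsometryEquiv.norm_map]
    exact hq y hy
  · filter_upwards [hd] with q hq y hy
    rw [map_smul]
    exact ((hq y hy).hasGradientAt.hasFDerivAt).mul_const (ρ q)

/-! ### The coverage region and the gradient of the cost -/

namespace CoverageProblem

variable (P : CoverageProblem)

/-- Periodicity lets the angle range over the closed interval. Compactness supplies both
measurability and finite volume. -/
theorem isCompact_region : IsCompact P.region := by
  have himg : P.region = (fun w : ℝ × ℝ =>
      polarPoint ((1 - w.2) * P.rIn w.1 + w.2 * P.rOut w.1) w.1) ''
        (Set.Icc 0 (2 * Real.pi) ×ˢ Set.Icc 0 1) := by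
    ext q
    constructor
    · rintro ⟨θ, hθ, r, hr, rfl⟩
      have hlt := P.rIn_lt_rOut θ
      refine ⟨(θ, (r - P.rIn θ) / (P.rOut θ - P.rIn θ)), ⟨⟨hθ.1, hθ.2.le⟩, ?_, ?_⟩, ?_⟩
      · exact div_nonneg (by linarith [hr.1]) (by linarith)
      · exact (div_le_one (by linarith)).2 (by linarith [hr.2])
      · have hne : P.rOut θ - P.rIn θ ≠ 0 := by linarith
        dsimp only
        congr 1
        field_simp
        ring
    · rintro ⟨⟨θ, s⟩, ⟨hθ, hs⟩, rfl⟩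
      dsimp only at hθ hs ⊢
      have hmem : ∀ t, (1 - s) * P.rIn t + s * P.rOut t ∈ Set.Icc (P.rIn t) (P.rOut t) := by
        intro t
        have hlt := P.rIn_lt_rOut t
        constructor <;> nlinarith [hs.1, hs.2]
      rcases hθ.2.lt_or_eq with h | rfl
      · exact ⟨θ, ⟨hθ.1, h⟩, _, hmem θ, rfl⟩
      · refine ⟨0, ⟨le_rfl, Real.two_pi_pos⟩, _, hmem 0, ?_⟩
        have h1 := P.rIn_periodic 0
        have h2 := P.rOut_periodic 0
        rw [zero_add] at h1 h2
        simp [polarPoint, h1, h2]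
  rw [himg]
  refine (isCompact_Icc.prod isCompact_Icc).image ?_
  have h1 := P.rIn_continuous
  have h2 := P.rOut_continuous
  unfold polarPoint
  fun_prop

theorem subregion_subset_region {N : ℕ} [NeZero N] {φ : Fin N → ℝ}
    (hφ : ∀ j, φ j ∈ Set.Ico 0 (2 * Real.pi)) (i : Fin N) : P.subregion φ i ⊆ P.region := by
  rintro q ⟨θ, hθ, hq⟩
  refine ⟨θ, ?_, hq⟩
  have h1 := hφ i
  have h2 := hφ (i + 1)
  unfold phases at hθ
  split_ifs at hθ
  · rcases hθ with h | h
    · exact ⟨h1.1.trans h.1.le, h.2⟩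
    · exact ⟨h.1, h.2.trans h2.2⟩
  · exact ⟨h1.1.trans hθ.1.le, hθ.2.trans h2.2⟩

/-- No measurability of `s` is needed: its restricted measure is dominated by that of the measurable
region. -/
theorem hasGradientAt_integral {s : Set Plane} (hs : s ⊆ P.region) {x : Plane} (hx : x ∈ P.dom) :
    HasGradientAt (fun y => ∫ q in s, P.f y q * P.ρ q)
      (∫ q in s, P.ρ q • gradient (fun y => P.f y q) x) x := by
  have hle : volume.restrict s ≤ volume.restrict P.region := Measure.restrict_mono_set _ hs
  have hae : ∀ᵐ q ∂volume.restrict s, q ∈ P.region :=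
    (Measure.absolutelyContinuous_of_le hle).ae_le
      (ae_restrict_mem P.isCompact_region.measurableSet)
  have : IsFiniteMeasure (volume.restrict s) :=
    isFiniteMeasure_restrict.2
      ((measure_mono hs).trans_lt P.isCompact_region.measure_lt_top).ne
  obtain ⟨K, hK, hKd, hKc⟩ := local_compact_nhds (P.dom_isOpen.mem_nhds hx)
  obtain ⟨C, hC⟩ := P.f_gradient_bounded K hKd hKc
  refine hasGradientAt_integral_of_bounded (U := K) (C := C) (M := P.ρHigh) hK
    (fun y hy => Integrable.mono_measure (P.f_integrable y (hKd hy)) hle) ?_ ?_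
    (P.ρ_aemeasurable.mono_measure hle).aestronglyMeasurable ?_
  · filter_upwards [hae] with q hq y hy
    exact ((P.f_contDiff q hq).differentiableOn one_ne_zero).differentiableAt
      (P.dom_isOpen.mem_nhds (hKd hy))
  · filter_upwards [hae] with q hq y hy
    exact hC y hy q hq
  · filter_upwards [hae] with q hq
    rw [Real.norm_of_nonneg (P.ρ_pos q hq).le]
    exact (P.ρ_mem q hq).2

theorem hasGradientAt_cost {N : ℕ} [NeZero N] {φ : Fin N → ℝ}
    (hφ : ∀ j, φ j ∈ Set.Ico 0 (2 * Real.pi)) (p : Fin N → Plane) (i : Fin N) {x : Plane}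
    (hx : x ∈ P.dom) :
    HasGradientAt (fun y => P.cost φ (Function.update p i y)) (P.gradCost φ i x) x := by
  have h := P.hasGradientAt_integral (P.subregion_subset_region hφ i) hx
  have hsplit : (fun y => P.cost φ (Function.update p i y)) = fun y =>
      (∫ q in P.subregion φ i, P.f y q * P.ρ q) +
        ∑ j ∈ Finset.univ.erase i, ∫ q in P.subregion φ j, P.f (p j) q * P.ρ q := by
    funext y
    rw [cost, ← Finset.add_sum_erase _ _ (Finset.mem_univ i), Function.update_self]
    congr 1
    refine Finset.sum_congr rfl fun j hj => ?_
    rw [Function.update_of_ne (Finset.ne_of_mem_erase hj)]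
  rw [hsplit, hasGradientAt_iff_hasFDerivAt]
  exact h.hasFDerivAt.add_const _

end CoverageProblem

/-! ### Zeros of outward gradient fields on a rectangle -/

theorem isCompact_rectangle (a₁ a₂ b₁ b₂ : ℝ) : IsCompact (rectangle a₁ a₂ b₁ b₂) := by
  have himg : rectangle a₁ a₂ b₁ b₂ =
      (fun w : ℝ × ℝ => (!₂[w.1, w.2] : Plane)) '' (Set.Icc a₁ a₂ ×ˢ Set.Icc b₁ b₂) := by
    ext x
    constructor
    · intro hx
      refine ⟨(x 0, x 1), hx, ?_⟩
      ext k
      fin_cases k <;> rfl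
    · rintro ⟨w, hw, rfl⟩
      exact hw
  rw [himg]
  exact (isCompact_Icc.prod isCompact_Icc).image (by fun_prop)

theorem affineMap_zero_coord (a₁ a₂ b₁ b₂ : ℝ) (z : Plane) :
    affineMap a₁ a₂ b₁ b₂ z 0 = (a₂ - a₁) / 2 * z 0 + (a₂ + a₁) / 2 := by
  simp [affineMap, scaleMatrix, centre, Matrix.toLpLin_apply]
  ring

theorem affineMap_one_coord (a₁ a₂ b₁ b₂ : ℝ) (z : Plane) :
    affineMap a₁ a₂ b₁ b₂ z 1 = (b₂ - b₁) / 2 * z 1 + (b₂ + b₁) / 2 := by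
  simp [affineMap, scaleMatrix, centre, Matrix.toLpLin_apply]
  ring

theorem affineMap_mem_rectangle {a₁ a₂ b₁ b₂ : ℝ} (ha : a₁ ≤ a₂) (hb : b₁ ≤ b₂) {z : Plane}
    (hz : z ∈ rectangle (-1) 1 (-1) 1) :
    affineMap a₁ a₂ b₁ b₂ z ∈ rectangle a₁ a₂ b₁ b₂ := by
  obtain ⟨⟨h1, h2⟩, h3, h4⟩ := hz
  refine ⟨?_, ?_⟩
  · rw [affineMap_zero_coord]
    constructor <;> nlinarith
  · rw [affineMap_one_coord]
    constructor <;> nlinarith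

theorem mem_frontier_square {z : Plane} (hz : z ∈ rectangle (-1) 1 (-1) 1) {v : Plane}
    (hv : ∀ t : ℝ, 0 < t → z + t • v ∉ rectangle (-1) 1 (-1) 1) :
    z ∈ frontier (rectangle (-1) 1 (-1) 1) := by
  refine ⟨subset_closure hz, fun hint => ?_⟩
  have hc : Filter.Tendsto (fun t : ℝ => z + t • v) (nhdsWithin 0 (Set.Ioi 0)) (nhds z) := by
    have : Continuous fun t : ℝ => z + t • v := by fun_prop
    simpa using (this.tendsto 0).mono_left nhdsWithin_le_nhds
  obtain ⟨t, ht, ht0⟩ :=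
    ((hc.eventually (mem_interior_iff_mem_nhds.1 hint)).and self_mem_nhdsWithin).exists
  exact hv t ht0 ht

/-- A gradient field on a rectangle that points outwards along the boundary has a zero. -/
theorem exists_gradient_eq_zero_of_outward {a₁ a₂ b₁ b₂ : ℝ} (ha : a₁ ≤ a₂) (hb : b₁ ≤ b₂)
    {J : Plane → ℝ} {F : Plane → Plane}
    (hJ : ∀ x ∈ rectangle a₁ a₂ b₁ b₂, HasGradientAt J (F x) x)
    (hF : ∀ z ∈ frontier (rectangle (-1) 1 (-1) 1),
      0 < inner ℝ (F (affineMap a₁ a₂ b₁ b₂ z)) z) :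
    ∃ x ∈ rectangle a₁ a₂ b₁ b₂, F x = 0 := by
  -- In a degenerate rectangle the boundary points `(1, 0)` and `(-1, 0)` have the same image, so
  -- one vector would have positive inner product with both.
  have hlt_a : a₁ < a₂ := by
    refine lt_of_le_of_ne ha ?_
    rintro rfl
    have hp := hF !₂[1, 0] (mem_frontier_square (v := !₂[1, 0]) (by simp [rectangle])
      fun t ht h => by
        have := h.1.2
        simp at this
        linarith)
    have hm := hF !₂[-1, 0] (mem_frontier_square (v := !₂[-1, 0]) (by simp [rectangle])
      fun t ht h => by
        have := h.1.1
        simp at this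
        linarith)
    have heq : affineMap a₁ a₁ b₁ b₂ !₂[-1, 0] = affineMap a₁ a₁ b₁ b₂ !₂[1, 0] := by
      ext k
      fin_cases k
      · simp [affineMap_zero_coord]
      · simp [affineMap_one_coord]
    rw [heq] at hm
    simp [PiLp.inner_apply, Fin.sum_univ_two] at hp hm
    linarith
  have hlt_b : b₁ < b₂ := by
    refine lt_of_le_of_ne hb ?_
    rintro rfl
    have hp := hF !₂[0, 1] (mem_frontier_square (v := !₂[0, 1]) (by simp [rectangle])
      fun t ht h => by
        have := h.2.2
        simp at this
        linarith)
    have hm := hF !₂[0, -1] (mem_frontier_square (v := !₂[0, -1]) (by simp [rectangle])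
      fun t ht h => by
        have := h.2.1
        simp at this
        linarith)
    have heq : affineMap a₁ a₂ b₁ b₁ !₂[0, -1] = affineMap a₁ a₂ b₁ b₁ !₂[0, 1] := by
      ext k
      fin_cases k
      · simp [affineMap_zero_coord]
      · simp [affineMap_one_coord]
    rw [heq] at hm
    simp [PiLp.inner_apply, Fin.sum_univ_two] at hp hm
    linarith
  have hα : 0 < (a₂ - a₁) / 2 := by linarith
  have hβ : 0 < (b₂ - b₁) / 2 := by linarith
  have hne : (rectangle a₁ a₂ b₁ b₂).Nonempty := ⟨!₂[a₁, b₁], by simp [rectangle, ha, hb]⟩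
  obtain ⟨x, hx, hmin⟩ := (isCompact_rectangle a₁ a₂ b₁ b₂).exists_isMinOn hne
    fun y hy => (hJ y hy).continuousAt.continuousWithinAt
  refine ⟨x, hx, ?_⟩
  -- The inverse of `z ↦ A z + b`.
  let G : Plane → Plane := fun y =>
    !₂[(y 0 - (a₂ + a₁) / 2) / ((a₂ - a₁) / 2), (y 1 - (b₂ + b₁) / 2) / ((b₂ - b₁) / 2)]
  have hGc : Continuous G := by
    have h0 := hα.ne'
    have h1 := hβ.ne'
    fun_prop (disch := assumption)
  have hGr : ∀ y, affineMap a₁ a₂ b₁ b₂ (G y) = y := by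
    intro y
    ext k
    fin_cases k
    · refine (affineMap_zero_coord _ _ _ _ _).trans ?_
      change _ * (_ / _) + _ = y 0
      rw [mul_div_cancel₀ _ hα.ne', sub_add_cancel]
    · refine (affineMap_one_coord _ _ _ _ _).trans ?_
      change _ * (_ / _) + _ = y 1
      rw [mul_div_cancel₀ _ hβ.ne', sub_add_cancel]
  have hGm : G x ∈ rectangle (-1) 1 (-1) 1 := by
    obtain ⟨⟨h1, h2⟩, h3, h4⟩ := hx
    refine ⟨⟨(le_div_iff₀ hα).2 ?_, (div_le_iff₀ hα).2 ?_⟩,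
      (le_div_iff₀ hβ).2 ?_, (div_le_iff₀ hβ).2 ?_⟩ <;> linarith
  by_cases hint : G x ∈ interior (rectangle (-1) 1 (-1) 1)
  · have hnhds : rectangle a₁ a₂ b₁ b₂ ∈ nhds x := by
      filter_upwards [hGc.continuousAt.preimage_mem_nhds (mem_interior_iff_mem_nhds.1 hint)]
        with y hy
      rw [← hGr y]
      exact affineMap_mem_rectangle ha hb hy
    have h0 := (hmin.isLocalMin hnhds).hasFDerivAt_eq_zero (hJ x hx).hasFDerivAt
    simpa using h0
  · exfalso
    have hpos := hF _ ⟨subset_closure hGm, hint⟩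
    rw [hGr] at hpos
    -- With `τ` at most each half-side, moving by `-tτ z` for `t ∈ [0, 1]` shrinks each offset from
    -- the centre without changing its sign.
    set τ := min ((a₂ - a₁) / 2) ((b₂ - b₁) / 2) with hτ
    have hτ0 : 0 < τ := lt_min hα hβ
    have hτa : τ ≤ (a₂ - a₁) / 2 := min_le_left _ _
    have hτb : τ ≤ (b₂ - b₁) / 2 := min_le_right _ _
    have hx0 : x 0 = (a₂ - a₁) / 2 * G x 0 + (a₂ + a₁) / 2 := by
      rw [← affineMap_zero_coord a₁ a₂ b₁ b₂, hGr]
    have hx1 : x 1 = (b₂ - b₁) / 2 * G x 1 + (b₂ + b₁) / 2 := by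
      rw [← affineMap_one_coord a₁ a₂ b₁ b₂, hGr]
    have hseg : segment ℝ x (x + -(τ • G x)) ⊆ rectangle a₁ a₂ b₁ b₂ := by
      rw [segment_eq_image']
      rintro _ ⟨t, ht, rfl⟩
      obtain ⟨⟨h1, h2⟩, h3, h4⟩ := hGm
      have htτ0 : 0 ≤ t * τ := mul_nonneg ht.1 hτ0.le
      have htτ : t * τ ≤ τ := mul_le_of_le_one_left hτ0.le ht.2
      have e0 : (x + t • (x + -(τ • G x) - x)) 0 =
          ((a₂ - a₁) / 2 - t * τ) * G x 0 + (a₂ + a₁) / 2 := by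
        simp only [add_sub_cancel_left, PiLp.add_apply, PiLp.smul_apply, PiLp.neg_apply,
          smul_eq_mul]
        rw [hx0]
        ring
      have e1 : (x + t • (x + -(τ • G x) - x)) 1 =
          ((b₂ - b₁) / 2 - t * τ) * G x 1 + (b₂ + b₁) / 2 := by
        simp only [add_sub_cancel_left, PiLp.add_apply, PiLp.smul_apply, PiLp.neg_apply,
          smul_eq_mul]
        rw [hx1]
        ring
      refine ⟨?_, ?_⟩
      · rw [e0]
        constructor <;> nlinarith
      · rw [e1]
        constructor <;> nlinarith
    -- Minimality along the segment forces `-τ ⟨F x, z⟩ ≥ 0` with `z = G x`, against `hpos`.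
    have hnn := (hmin.localize).hasFDerivWithinAt_nonneg
      (hJ x hx).hasFDerivAt.hasFDerivWithinAt (mem_posTangentConeAt_of_segment_subset hseg)
    rw [InnerProductSpace.toDual_apply_apply, inner_neg_right, inner_smul_right] at hnn
    nlinarith

theorem proposition1 (P : CoverageProblem) {N : ℕ} [NeZero N]
    (φ : Fin N → ℝ) (hφ : ∀ j, φ j ∈ Set.Ico 0 (2 * Real.pi))
    (p : Fin N → Plane) (hp : ∀ j, p j ∈ P.region) (i : Fin N)
    (a₁ a₂ b₁ b₂ : ℝ) (ha : a₁ ≤ a₂) (hb : b₁ ≤ b₂)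
    (hD : rectangle a₁ a₂ b₁ b₂ ⊆ P.dom) :
    (∀ x ∈ rectangle a₁ a₂ b₁ b₂,
      HasGradientAt (fun y => P.cost φ (Function.update p i y)) (P.gradCost φ i x) x) ∧
    ((∀ z ∈ frontier (rectangle (-1) 1 (-1) 1),
        0 < inner ℝ (P.gradCost φ i (affineMap a₁ a₂ b₁ b₂ z)) z) →
      ∃ x ∈ rectangle a₁ a₂ b₁ b₂, P.gradCost φ i x = 0) := by
  have hgrad : ∀ x ∈ rectangle a₁ a₂ b₁ b₂,
      HasGradientAt (fun y => P.cost φ (Function.update p i y)) (P.gradCost φ i x) x :=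
    fun x hx => P.hasGradientAt_cost hφ p i (hD hx)
  exact ⟨hgrad, exists_gradient_eq_zero_of_outward ha hb hgrad⟩
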